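/- Let $n,m\ge 1$ be integers, $T>0$, $x^0\in\mathbb{R}^n$, and let $f:\mathbb{R}^n\times\mathbb{R}^m\times[0,T]\to\mathbb{R}^n$ be a continuous mapping of class $\mathrm{C}^1$ with respect to its first two variables (i.e. for every $t\in[0,T]$ the map $(x,u)\mapsto f(x,u,t)$ is differentiable, and its differential is continuous in $(x,u,t)\in\mathbb{R}^n\times\mathbb{R}^m\times[0,T]$). A control $u\in \mathrm{L}^\infty([0,T],\mathbb{R}^m)$ is called admissible if there is an absolutely continuous $x:[0,T]\to\mathbb{R}^n$ with $x(0)=x^0$ and $\dot x(t)=f(x(t),u(t),t)$ for a.e. $t\in[0,T]$; this $x$ is then unique and is denoted by $x_u$. Let $\mathcal{U}$ be the set of admissible controls, which is open in $\mathrm{L}^\infty([0,T],\mathbb{R}^m)$, and let $\mathrm{E}:\mathcal{U}\to\mathbb{R}^n$, $\mathrm{E}(u)=x_u(T)$, be the end-point mapping, which is of class $\mathrm{C}^1$. For $\mathrm{U}\subset\mathbb{R}^m$ let $\mathrm{L}^\infty([0,T],\mathrm{U})$ be the set of controls with values in $\mathrm{U}$ almost everywhere. A point $x^1\in\mathbb{R}^n$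 is called $\mathrm{L}^\infty_{\mathrm{U}}$-reachable in time $T$ from $x^0$ if $x^1=x_u(T)$ for some $u\in\mathcal{U}\cap \mathrm{L}^\infty([0,T],\mathrm{U})$, and the $\mathrm{L}^\infty_{\mathrm{U}}$-accessible set is $\mathrm{E}(\mathcal{U}\cap \mathrm{L}^\infty([0,T],\mathrm{U}))$. Assume that $\mathrm{U}$ is nonempty and convex, and let $u\in\mathcal{U}\cap \mathrm{L}^\infty([0,T],\mathrm{U})$ be strongly $\mathrm{U}$-regular, i.e. the Fréchet differential $\mathrm{D}\mathrm{E}(u)$ maps the tangent cone $\mathbb{R}_+\big(\mathrm{L}^\infty([0,T],\mathrm{U})-u\big)$ onto $\mathbb{R}^n$. Then there exist an open neighborhood $\mathcal{V}$ of $x_u(T)$ in $\mathbb{R}^n$ and a mapping $V:\mathcal{V}\to\mathcal{U}\cap \mathrm{L}^\infty([0,T],\mathrm{U})$, continuous for the $\mathrm{L}^\infty$ norm, such that $V(x_u(T))=u$ and $\mathrm{E}(V(z))=z$ for every $z\in\mathcal{V}$. In particular, every point of $\mathcal{V}$ is $\mathrm{L}^\infty_{\mathrm{U}}$-reachable in time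 $T$ from $x^0$, and thus $x_u(T)$ belongs to the interior of the $\mathrm{L}^\infty_{\mathrm{U}}$-accessible set. -/

import Mathlib

open MeasureTheory Set
open scoped ENNReal

namespace ControlSampling

/-- The Lebesgue space `L^∞([0,T], ℝ^m)` of controls (classes modulo a.e. equality), with its
essential supremum norm. -/
abbrev Control (m : ℕ) (T : ℝ) : Type :=
  Lp (EuclideanSpace ℝ (Fin m)) ∞ (volume.restrict (Icc (0 : ℝ) T))

/-- The dynamics `f : ℝ^n × ℝ^m × [0,T] → ℝ^n` is continuous and of class `C^1` with respect to its
first two variables: for every `t ∈ [0,T]` the map `(x, u) ↦ f(x,u,t)` is differentiable, and its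
differential is continuous in `(x,u,t) ∈ ℝ^n × ℝ^m × [0,T]`. The values of `f` for `t ∉ [0,T]` play
no role. -/
structure IsC1Dynamics {n m : ℕ} (T : ℝ)
    (f : EuclideanSpace ℝ (Fin n) → EuclideanSpace ℝ (Fin m) → ℝ → EuclideanSpace ℝ (Fin n)) :
    Prop where
  continuousOn : ContinuousOn
    (fun q : (EuclideanSpace ℝ (Fin n) × EuclideanSpace ℝ (Fin m)) × ℝ => f q.1.1 q.1.2 q.2)
    (univ ×ˢ Icc 0 T)
  differentiable : ∀ t ∈ Icc 0 T, Differentiable ℝ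
    (fun p : EuclideanSpace ℝ (Fin n) × EuclideanSpace ℝ (Fin m) => f p.1 p.2 t)
  continuousOn_fderiv : ContinuousOn
    (fun q : (EuclideanSpace ℝ (Fin n) × EuclideanSpace ℝ (Fin m)) × ℝ =>
      fderiv ℝ (fun p : EuclideanSpace ℝ (Fin n) × EuclideanSpace ℝ (Fin m) => f p.1 p.2 q.2) q.1)
    (univ ×ˢ Icc 0 T)

/-- `(x, u)` is a solution to the control system: `x` is absolutely continuous on `[0,T]` and
`ẋ(t) = f(x(t),u(t),t)` for a.e. `t ∈ [0,T]`. -/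
def IsSolution {n m : ℕ} (T : ℝ)
    (f : EuclideanSpace ℝ (Fin n) → EuclideanSpace ℝ (Fin m) → ℝ → EuclideanSpace ℝ (Fin n))
    (x : ℝ → EuclideanSpace ℝ (Fin n)) (u : Control m T) : Prop :=
  AbsolutelyContinuousOnInterval x 0 T ∧
    ∀ᵐ t ∂(volume.restrict (Icc (0 : ℝ) T)), HasDerivAt x (f (x t) (u t) t) t

/-- The set of admissible controls: those for which a solution starting at `x₀` exists on the whole
of `[0,T]`. -/
def admissibleControls {n m : ℕ} (T : ℝ)
    (f : EuclideanSpace ℝ (Fin n) → EuclideanSpace ℝ (Fin m) → ℝ → EuclideanSpace ℝ (Fin n))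
    (x₀ : EuclideanSpace ℝ (Fin n)) : Set (Control m T) :=
  {u | ∃ x : ℝ → EuclideanSpace ℝ (Fin n), x 0 = x₀ ∧ IsSolution T f x u}

open Classical in
/-- The trajectory `x_u` on `[0,T]` of an admissible control `u` (for a `C^1` dynamics it is unique
on `[0,T]`); the value `0` is used when `u` is not admissible. -/
noncomputable def trajectory {n m : ℕ} (T : ℝ)
    (f : EuclideanSpace ℝ (Fin n) → EuclideanSpace ℝ (Fin m) → ℝ → EuclideanSpace ℝ (Fin n))
    (x₀ : EuclideanSpace ℝ (Fin n)) (u : Control m T) : ℝ → EuclideanSpace ℝ (Fin n) :=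
  if h : u ∈ admissibleControls T f x₀ then h.choose else 0

/-- The end-point mapping `E(u) = x_u(T)`. -/
noncomputable def endpointMap {n m : ℕ} (T : ℝ)
    (f : EuclideanSpace ℝ (Fin n) → EuclideanSpace ℝ (Fin m) → ℝ → EuclideanSpace ℝ (Fin n))
    (x₀ : EuclideanSpace ℝ (Fin n)) (u : Control m T) : EuclideanSpace ℝ (Fin n) :=
  trajectory T f x₀ u T

/-- `L^∞([0,T], U)`: the controls with values in `U` almost everywhere. -/
def controlsIn {m : ℕ} (T : ℝ) (U : Set (EuclideanSpace ℝ (Fin m))) : Set (Control m T) :=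
  {u | ∀ᵐ t ∂(volume.restrict (Icc (0 : ℝ) T)), u t ∈ U}

/-- `x₁` is `L^∞_U`-reachable in time `T` from `x₀`. -/
def IsReachable {n m : ℕ} (T : ℝ)
    (f : EuclideanSpace ℝ (Fin n) → EuclideanSpace ℝ (Fin m) → ℝ → EuclideanSpace ℝ (Fin n))
    (x₀ : EuclideanSpace ℝ (Fin n)) (U : Set (EuclideanSpace ℝ (Fin m)))
    (x₁ : EuclideanSpace ℝ (Fin n)) : Prop :=
  ∃ (x : ℝ → EuclideanSpace ℝ (Fin n)) (u : Control m T),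
    IsSolution T f x u ∧ u ∈ controlsIn T U ∧ x 0 = x₀ ∧ x T = x₁

/-- The `L^∞_U`-accessible set: the image under the end-point mapping of the admissible controls
with values in `U`. -/
def accessibleSet {n m : ℕ} (T : ℝ)
    (f : EuclideanSpace ℝ (Fin n) → EuclideanSpace ℝ (Fin m) → ℝ → EuclideanSpace ℝ (Fin n))
    (x₀ : EuclideanSpace ℝ (Fin n)) (U : Set (EuclideanSpace ℝ (Fin m))) :
    Set (EuclideanSpace ℝ (Fin n)) :=
  endpointMap T f x₀ '' (admissibleControls T f x₀ ∩ controlsIn T U)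

/-- The tangent cone `ℝ_+ (L^∞([0,T],U) - u)`, for convex `U`, to `L^∞([0,T],U)` at `u`. -/
def controlTangentCone {m : ℕ} (T : ℝ) (U : Set (EuclideanSpace ℝ (Fin m))) (u : Control m T) :
    Set (Control m T) :=
  {v | ∃ c : ℝ, 0 ≤ c ∧ ∃ w ∈ controlsIn T U, v = c • (w - u)}

/-- `u` is strongly `U`-regular: the Fréchet differential `DE(u)` of the end-point mapping sends the
tangent cone to `L^∞([0,T],U)` at `u` onto `ℝ^n`. -/
def IsStronglyURegular {n m : ℕ} (T : ℝ)
    (f : EuclideanSpace ℝ (Fin n) → EuclideanSpace ℝ (Fin m) → ℝ → EuclideanSpace ℝ (Fin n))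
    (x₀ : EuclideanSpace ℝ (Fin n)) (U : Set (EuclideanSpace ℝ (Fin m))) (u : Control m T) :
    Prop :=
  fderiv ℝ (endpointMap T f x₀) u '' controlTangentCone T U u = univ

end ControlSampling

/-! Strict regularity gives finitely many admissible directions `w j - u` whose images under
`DE(u)`, after nonnegative scaling, are the vectors `±e_i`. Splitting the coordinates of `y` into
positive and negative parts gives a Lipschitz right inverse `σ` of `DE(u)`, in general not linear.
By convexity, `u + σ y` stays among the `U`-valued controls for small `y`. The map `y ↦ E(u + σ y)`
has the identity as strict derivative at `0`, since the strict remainder is controlled by `‖σ y - σ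
y'‖ ≤ M ‖y - y'‖`. The ordinary inverse function theorem in `ℝ^n` then inverts it
(`HasStrictFDerivAt.exists_continuousOn_rightInverse_of_convex`).

It remains to prove that `E` is strictly differentiable at `u` and that nearby controls are
admissible (`exists_hasStrictFDerivAt_endpointMap`). The control system is rewritten as `y - ∫_0^·
f(y, v, s) ds = x₀` in `L^∞`. The superposition operator is strictly differentiable
(`hasStrictFDerivAt_nemytskii`), the linearization in `y` is identity minus Volterra, hence
invertible (`isUnit_one_sub_volterra_comp`), and the implicit function theorem applies. -/

open Filter Topology

/-! ### Almost-everywhere bounds and the `L^∞` norm. -/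

section EssentialSupremum

variable {α E : Type*} [MeasurableSpace α] {μ : Measure α} [NormedAddCommGroup E]

theorem MeasureTheory.Lp.ae_norm_le_norm (g : Lp E ∞ μ) : ∀ᵐ t ∂μ, ‖g t‖ ≤ ‖g‖ := by
  filter_upwards [enorm_ae_le_eLpNormEssSup g μ] with t ht
  rw [Lp.norm_def, eLpNorm_exponent_top, ← toReal_enorm]
  refine ENNReal.toReal_mono ?_ ht
  simpa using Lp.eLpNorm_ne_top g

theorem MeasureTheory.Lp.norm_top_le_of_ae_bound {g : Lp E ∞ μ} {C : ℝ} (hC : 0 ≤ C)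
    (h : ∀ᵐ t ∂μ, ‖g t‖ ≤ C) : ‖g‖ ≤ C := by
  rw [Lp.norm_def, eLpNorm_exponent_top]
  exact ENNReal.toReal_le_of_le_ofReal hC (eLpNormEssSup_le_of_ae_bound h)

end EssentialSupremum

/-! ### Superposition operators on `L^∞`. -/

section Nemytskii

variable {α K E F : Type*} [MeasurableSpace α] {μ : Measure α}
  [TopologicalSpace K] [CompactSpace K]
  [NormedAddCommGroup E] [ProperSpace E] [NormedAddCommGroup F]

theorem memLp_top_comp_of_continuous {h : E → K → F} (hh : Continuous (Function.uncurry h))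
    {ρ : α → K} (hρ : AEStronglyMeasurable ρ μ) (ξ : Lp E ∞ μ) : MemLp (fun t => h (ξ t) (ρ t)) ∞ μ := by
  obtain ⟨C, hC⟩ := ((isCompact_closedBall (0 : E) ‖ξ‖).prod
    (isCompact_univ (X := K))).exists_bound_of_continuousOn hh.continuousOn
  refine memLp_top_of_bound
    (hh.comp_aestronglyMeasurable ((Lp.aestronglyMeasurable ξ).prodMk hρ)) C ?_
  filter_upwards [Lp.ae_norm_le_norm ξ] with t ht
  exact hC (ξ t, ρ t) ⟨by simpa using ht, mem_univ _⟩

/-- The superposition operator `ξ ↦ h(ξ(·), ρ(·))` on `L^∞` of a continuous map `h`. -/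
noncomputable def nemytskii {h : E → K → F} (hh : Continuous (Function.uncurry h))
    {ρ : α → K} (hρ : AEStronglyMeasurable ρ μ) (ξ : Lp E ∞ μ) : Lp F ∞ μ :=
  (memLp_top_comp_of_continuous hh hρ ξ).toLp _

theorem coeFn_nemytskii {h : E → K → F} (hh : Continuous (Function.uncurry h))
    {ρ : α → K} (hρ : AEStronglyMeasurable ρ μ) (ξ : Lp E ∞ μ) :
    nemytskii hh hρ ξ =ᵐ[μ] fun t => h (ξ t) (ρ t) :=
  MemLp.coeFn_toLp _

/-- A continuous map is uniformly continuous near compact sets, uniformly in a compact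
parameter. -/
theorem exists_forall_closedBall_dist_lt {h : E → K → F} (hh : Continuous (Function.uncurry h))
    (R : ℝ) {ε : ℝ} (hε : 0 < ε) : ∃ δ > 0, ∀ x ∈ Metric.closedBall (0 : E) R, ∀ y, dist x y < δ → ∀ k,
      dist (h x k) (h y k) < ε := by
  -- Currying into `C(K, F)` turns uniformity in `k` into continuity for the sup norm.
  let g : E → C(K, F) := fun x => ⟨h x, by fun_prop⟩
  have hg : Continuous g := ContinuousMap.continuous_of_continuous_uncurry _ hh
  -- The margin `1` in the radius lets `y` lie slightly outside the ball of radius `R`.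
  have huc := (isCompact_closedBall (0 : E) (R + 1)).uniformContinuousOn_of_continuous
    hg.continuousOn
  rw [Metric.uniformContinuousOn_iff] at huc
  obtain ⟨δ, hδ, H⟩ := huc ε hε
  refine ⟨min δ 1, by positivity, fun x hx y hxy k => ?_⟩
  rw [mem_closedBall_zero_iff] at hx
  refine (ContinuousMap.dist_apply_le_dist (f := g x) (g := g y) k).trans_lt
    (H x ?_ y ?_ (hxy.trans_le (min_le_left _ _)))
  · rw [mem_closedBall_zero_iff]; linarith
  · rw [mem_closedBall_zero_iff]
    have h1 : dist x y < 1 := hxy.trans_le (min_le_right _ _)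
    rw [dist_comm, dist_eq_norm] at h1
    have := norm_le_norm_add_norm_sub' y x
    linarith

variable [NormedSpace ℝ E] [NormedSpace ℝ F]

/-- The values of `ξ` lie a.e. in one compact ball, so `h'` has a modulus of continuity there
independent of `t`. The mean value inequality, applied for a.e. fixed `t`, then gives a remainder
bound uniform in `t`, as the `L^∞` norm requires. -/
theorem hasStrictFDerivAt_nemytskii {h : E → K → F} (hh : Continuous (Function.uncurry h))
    {h' : E → K → E →L[ℝ] F}
    (hh' : Continuous (Function.uncurry h'))
    (hd : ∀ k x, HasFDerivAt (fun y => h y k) (h' x k) x) {ρ : α → K}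
    (hρ : AEStronglyMeasurable ρ μ) (ξ : Lp E ∞ μ) :
    HasStrictFDerivAt (nemytskii hh hρ)
      ((ContinuousLinearMap.id ℝ (E →L[ℝ] F)).holderL μ ∞ ∞ ∞ (nemytskii hh' hρ ξ)) ξ := by
  rw [hasStrictFDerivAt_iff_isLittleO, Asymptotics.isLittleO_iff]
  intro c hc
  obtain ⟨δ, hδ, H⟩ := exists_forall_closedBall_dist_lt hh' ‖ξ‖ hc
  have hnear : ∀ᶠ p : Lp E ∞ μ × Lp E ∞ μ in 𝓝 (ξ, ξ),
      p.1 ∈ Metric.ball ξ δ ∧ p.2 ∈ Metric.ball ξ δ :=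
    prod_mem_nhds (Metric.ball_mem_nhds ξ hδ) (Metric.ball_mem_nhds ξ hδ)
  filter_upwards [hnear] with ⟨ζ, η⟩ ⟨hζ, hη⟩
  simp only [Metric.mem_ball, dist_eq_norm] at hζ hη
  refine Lp.norm_top_le_of_ae_bound (by positivity) ?_
  · filter_upwards [Lp.coeFn_sub (nemytskii hh hρ ζ - nemytskii hh hρ η)
        ((ContinuousLinearMap.id ℝ (E →L[ℝ] F)).holder ∞ (nemytskii hh' hρ ξ) (ζ - η)),
      Lp.coeFn_sub (nemytskii hh hρ ζ) (nemytskii hh hρ η), coeFn_nemytskii hh hρ ζ,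
      coeFn_nemytskii hh hρ η, coeFn_nemytskii hh' hρ ξ,
      (ContinuousLinearMap.id ℝ (E →L[ℝ] F)).coeFn_holder (r := ∞) (nemytskii hh' hρ ξ) (ζ - η),
      Lp.coeFn_sub ζ η, Lp.coeFn_sub ζ ξ, Lp.coeFn_sub η ξ, Lp.ae_norm_le_norm ξ,
      Lp.ae_norm_le_norm (ζ - η), Lp.ae_norm_le_norm (ζ - ξ), Lp.ae_norm_le_norm (η - ξ)]
      with t h1 h2 h3 h4 h5 h6 h7 h8 h9 h10 h11 h12 h13
    simp only [ContinuousLinearMap.holderL_apply_apply]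
    rw [h1, Pi.sub_apply, h2, Pi.sub_apply, h3, h4, h6, h5, h7]
    rw [h7] at h11
    rw [h8] at h12
    rw [h9] at h13
    simp only [Pi.sub_apply, ContinuousLinearMap.id_apply] at *
    refine le_trans ?_ (mul_le_mul_of_nonneg_left h11 hc.le)
    refine (convex_ball (ξ t) δ).norm_image_sub_le_of_norm_hasFDerivWithin_le'
      (f' := fun y => h' y (ρ t)) (fun y _ => (hd (ρ t) y).hasFDerivWithinAt)
      (fun y hy => ?_) ?_ ?_
    · rw [← dist_eq_norm, dist_comm]
      exact (H (ξ t) (by simpa using h10) y (by rwa [Metric.mem_ball, dist_comm] at hy) _).le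
    · rw [Metric.mem_ball, dist_eq_norm]; exact h13.trans_lt hη
    · rw [Metric.mem_ball, dist_eq_norm]; exact h12.trans_lt hζ

end Nemytskii

/-! ### Inverse functions with values in a convex set. -/

section ConvexInverse

theorem Convex.add_sum_smul_sub_mem {X ι : Type*} [AddCommGroup X] [Module ℝ X] {C : Set X}
    (hC : Convex ℝ C) {u : X} (hu : u ∈ C) {s : Finset ι} {b : ι → ℝ} {w : ι → X}
    (hw : ∀ i ∈ s, w i ∈ C) (hb : ∀ i ∈ s, 0 ≤ b i) (hs : ∑ i ∈ s, b i ≤ 1) :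
    u + ∑ i ∈ s, b i • (w i - u) ∈ C := by
  -- The center of mass divides by the total weight, so zero weight is treated apart.
  rcases (Finset.sum_nonneg hb).eq_or_lt with h0 | h0
  · rw [eq_comm, Finset.sum_eq_zero_iff_of_nonneg hb] at h0
    rw [Finset.sum_eq_zero fun i hi => by rw [h0 i hi, zero_smul], add_zero]
    exact hu
  · have := hC.add_smul_sub_mem hu (hC.centerMass_mem hb h0 hw) ⟨h0.le, hs⟩
    convert this using 2
    rw [Finset.centerMass, smul_sub, smul_inv_smul₀ h0.ne', Finset.sum_smul,
      ← Finset.sum_sub_distrib]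
    simp only [smul_sub]

variable {X : Type*} [NormedAddCommGroup X] [NormedSpace ℝ X] {n : ℕ}

/-- If a linear map sends a cone with vertex at a point of a convex set onto `ℝ^n`, it has a
Lipschitz right inverse whose values near the origin are tangent vectors staying in the convex
set. -/
theorem exists_lipschitz_rightInverse_of_convex
    {D : X →L[ℝ] EuclideanSpace ℝ (Fin n)} {C : Set X} (hC : Convex ℝ C) {u : X} (hu : u ∈ C)
    (hD : D '' {v | ∃ c : ℝ, 0 ≤ c ∧ ∃ w ∈ C, v = c • (w - u)} = univ) :
    ∃ (M : ℝ) (σ : EuclideanSpace ℝ (Fin n) → X), (∀ y, D (σ y) = y) ∧ σ 0 = 0 ∧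
      (∀ y y', ‖σ y - σ y'‖ ≤ M * ‖y - y'‖) ∧ ∀ᶠ y in 𝓝 0, u + σ y ∈ C := by
  -- The pairs in `Fin n × Bool` index the vectors `±e_i`, which generate `ℝ^n` with nonnegative
  -- coefficients only.
  let sgn : Bool → ℝ := fun b => if b then 1 else -1
  have key : ∀ j : Fin n × Bool, ∃ c : ℝ, 0 ≤ c ∧ ∃ w ∈ C,
      D (c • (w - u)) = sgn j.2 • EuclideanSpace.single j.1 (1 : ℝ) := by
    intro j
    obtain ⟨v, ⟨c, hc, w, hw, rfl⟩, h⟩ :=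
      hD.symm ▸ mem_univ (sgn j.2 • EuclideanSpace.single j.1 (1 : ℝ))
    exact ⟨c, hc, w, hw, h⟩
  choose c hc w hw hDw using key
  -- These coefficients are the positive and negative parts of the coordinates: nonnegative,
  -- 1-Lipschitz and zero at the origin.
  let a : EuclideanSpace ℝ (Fin n) → Fin n × Bool → ℝ := fun y j => max (sgn j.2 * y j.1) 0
  have ha : ∀ y y' j, ‖a y j - a y' j‖ ≤ ‖y - y'‖ := by
    intro y y' j
    refine (abs_max_sub_max_le_abs _ _ _).trans ?_
    rw [← mul_sub, abs_mul, show |sgn j.2| = 1 by simp only [sgn]; split_ifs <;> simp, one_mul]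
    exact PiLp.norm_apply_le (y - y') j.1
  have hac : ∀ j, Continuous fun y => a y j := fun j => by simp only [a]; fun_prop
  have ha0 : ∀ j, a 0 j = 0 := by simp [a]
  refine ⟨∑ j, ‖c j • (w j - u)‖, fun y => ∑ j, a y j • c j • (w j - u), fun y => ?_, ?_,
    fun y y' => ?_, ?_⟩
  · simp only [map_sum, map_smul] at hDw ⊢
    simp only [hDw, Fintype.sum_prod_type, Fintype.sum_bool]
    ext i
    simp only [WithLp.ofLp_sum, Finset.sum_apply, PiLp.add_apply, PiLp.smul_apply, smul_eq_mul,
      sgn, a, if_true, Bool.false_eq_true, if_false]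
    rw [Finset.sum_eq_single i (fun k _ hk => by simp [hk]) (by simp)]
    simp only [PiLp.single_apply, if_true]
    rcases le_total 0 (y i) with h | h <;> simp [h]
  · simp [ha0]
  · rw [← Finset.sum_sub_distrib, Finset.sum_mul]
    refine norm_sum_le_of_le _ fun j _ => ?_
    rw [← sub_smul, norm_smul, mul_comm]
    exact mul_le_mul_of_nonneg_left (ha y y' j) (norm_nonneg _)
  -- The total weight on the directions `w j - u` tends to `0`; once it is at most `1`, convexity
  -- applies.
  · have hlim : Tendsto (fun y => ∑ j, a y j * c j) (𝓝 0) (𝓝 0) := by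
      have : Continuous fun y => ∑ j, a y j * c j := by fun_prop
      simpa [ha0] using this.tendsto 0
    filter_upwards [hlim.eventually_le_const zero_lt_one] with y hy
    simp only [smul_smul]
    exact hC.add_sum_smul_sub_mem hu (fun j _ => hw j)
      (fun j _ => mul_nonneg (le_max_right _ _) (hc j)) hy

/-- **Conic inverse function theorem**: a map whose strict derivative sends the tangent cone to a
convex set onto `ℝ^n` has a continuous local right inverse with values in the convex set. -/
theorem HasStrictFDerivAt.exists_continuousOn_rightInverse_of_convex
    {f : X → EuclideanSpace ℝ (Fin n)} {D : X →L[ℝ] EuclideanSpace ℝ (Fin n)} {u : X}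
    (hf : HasStrictFDerivAt f D u) {C : Set X} (hC : Convex ℝ C) (hu : u ∈ C)
    (hD : D '' {v | ∃ c : ℝ, 0 ≤ c ∧ ∃ w ∈ C, v = c • (w - u)} = univ)
    {A : Set X} (hA : A ∈ 𝓝 u) :
    ∃ (𝒱 : Set (EuclideanSpace ℝ (Fin n))) (V : EuclideanSpace ℝ (Fin n) → X),
      IsOpen 𝒱 ∧ f u ∈ 𝒱 ∧ ContinuousOn V 𝒱 ∧ (∀ z ∈ 𝒱, V z ∈ A ∩ C) ∧ V (f u) = u ∧
      ∀ z ∈ 𝒱, f (V z) = z := by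
  obtain ⟨M, σ, hDσ, hσ0, hσ, hσC⟩ := exists_lipschitz_rightInverse_of_convex hC hu hD
  have hσc : Continuous σ := (LipschitzWith.of_dist_le' fun y y' => by
    simpa only [dist_eq_norm] using hσ y y').continuous
  have hlim : Tendsto (fun y => u + σ y) (𝓝 0) (𝓝 u) := by
    have : Continuous fun y => u + σ y := by fun_prop
    simpa [hσ0] using this.tendsto 0
  let F : EuclideanSpace ℝ (Fin n) → EuclideanSpace ℝ (Fin n) := fun y => f (u + σ y)
  -- Since `D ∘ σ = id`, the remainder of `F` is that of `f` along `u + σ y`; `σ` itself need not be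
  -- differentiable.
  have hF : HasStrictFDerivAt F
      ((ContinuousLinearEquiv.refl ℝ (EuclideanSpace ℝ (Fin n)) :
        EuclideanSpace ℝ (Fin n) →L[ℝ] EuclideanSpace ℝ (Fin n))) 0 := by
    rw [hasStrictFDerivAt_iff_isLittleO]
    have hlim2 : Tendsto (fun p : EuclideanSpace ℝ (Fin n) × EuclideanSpace ℝ (Fin n) =>
        (u + σ p.1, u + σ p.2)) (𝓝 (0, 0)) (𝓝 (u, u)) := by
      rw [nhds_prod_eq, nhds_prod_eq]
      exact hlim.prodMap hlim
    have hO : (fun p : EuclideanSpace ℝ (Fin n) × EuclideanSpace ℝ (Fin n) =>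
        (u + σ p.1) - (u + σ p.2)) =O[𝓝 (0, 0)] fun p => p.1 - p.2 :=
      Asymptotics.IsBigO.of_bound M (Eventually.of_forall fun p => by
        simpa only [add_sub_add_left_eq_sub] using hσ p.1 p.2)
    have := (hf.isLittleO.comp_tendsto hlim2).trans_isBigO hO
    refine this.congr_left fun p => ?_
    simp [F, hDσ]
  let P := hF.toOpenPartialHomeomorph F
  have h0 : (0 : EuclideanSpace ℝ (Fin n)) ∈ P.source :=
    hF.mem_toOpenPartialHomeomorph_source
  have hP : ∀ y, P y = f (u + σ y) := fun y => rfl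
  have hP0 : P 0 = f u := by rw [hP, hσ0, add_zero]
  obtain ⟨O, hO, hOo, hO0⟩ := mem_nhds_iff.1 (hσC.and (hlim hA))
  refine ⟨P.symm.source ∩ P.symm ⁻¹' O, fun z => u + σ (P.symm z),
    P.symm.isOpen_inter_preimage hOo, ⟨?_, ?_⟩, ?_, fun z hz => ?_, ?_, fun z hz => ?_⟩
  · rw [← hP0]; exact P.map_source h0
  · rw [← hP0, mem_preimage, P.left_inv h0]; exact hO0
  · exact (continuous_const.add hσc).comp_continuousOn
      (P.symm.continuousOn.mono inter_subset_left)
  · exact (hO hz.2).symm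
  · simp only [← hP0, P.left_inv h0, hσ0, add_zero]
  · rw [← hP]; exact P.right_inv hz.1

end ConvexInverse

/-! ### Volterra operators on `L^∞([0,T])`. -/

section Volterra

variable {F : Type*} [NormedAddCommGroup F] {T : ℝ}

theorem intervalIntegrable_of_mem_Lp_top (g : Lp F ∞ (volume.restrict (Icc (0 : ℝ) T)))
    {a b : ℝ} (ha : a ∈ Icc 0 T) (hb : b ∈ Icc 0 T) : IntervalIntegrable g volume a b := by
  have h : IntegrableOn g (Icc 0 T) := (Lp.memLp g).integrable le_top
  rw [intervalIntegrable_iff]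
  exact h.mono_set (uIoc_subset_uIcc.trans (uIcc_subset_Icc ha hb))

variable [NormedSpace ℝ F]

theorem norm_intervalIntegral_le_of_mem_Lp_top
    (g : Lp F ∞ (volume.restrict (Icc (0 : ℝ) T))) {a b : ℝ} (ha : a ∈ Icc 0 T)
    (hb : b ∈ Icc 0 T) : ‖∫ s in a..b, g s‖ ≤ ‖g‖ * |b - a| := by
  refine intervalIntegral.norm_integral_le_of_norm_le_const_ae ?_
  have := (ae_restrict_iff' measurableSet_Icc).1 (Lp.ae_norm_le_norm g)
  filter_upwards [this] with s hs hs'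
  exact hs (uIcc_subset_Icc ha hb (uIoc_subset_uIcc hs'))

theorem lipschitzOnWith_intervalIntegral_of_mem_Lp_top
    (g : Lp F ∞ (volume.restrict (Icc (0 : ℝ) T))) :
    LipschitzOnWith ‖g‖₊ (fun t => ∫ s in (0 : ℝ)..t, g s) (Icc 0 T) := by
  refine LipschitzOnWith.of_dist_le_mul fun x hx y hy => ?_
  have h0 : (0 : ℝ) ∈ Icc 0 T := left_mem_Icc.2 (hx.1.trans hx.2)
  rw [dist_eq_norm, Real.dist_eq, intervalIntegral.integral_interval_sub_left
    (intervalIntegrable_of_mem_Lp_top g h0 hx) (intervalIntegrable_of_mem_Lp_top g h0 hy)]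
  exact norm_intervalIntegral_le_of_mem_Lp_top g hy hx

theorem memLp_top_intervalIntegral (g : Lp F ∞ (volume.restrict (Icc (0 : ℝ) T))) :
    MemLp (fun t => ∫ s in (0 : ℝ)..t, g s) ∞ (volume.restrict (Icc (0 : ℝ) T)) := by
  refine memLp_top_of_bound ((lipschitzOnWith_intervalIntegral_of_mem_Lp_top
    g).continuousOn.aestronglyMeasurable measurableSet_Icc) (‖g‖ * T) ?_
  filter_upwards [ae_restrict_mem measurableSet_Icc] with t ht
  refine (norm_intervalIntegral_le_of_mem_Lp_top g
    (left_mem_Icc.2 (ht.1.trans ht.2)) ht).trans ?_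
  rw [sub_zero, abs_of_nonneg ht.1]
  exact mul_le_mul_of_nonneg_left ht.2 (norm_nonneg _)

/-- Integration over `[0,t]`, for `t ∈ [0,T]`, as a continuous linear map on `L^∞([0,T])`. -/
noncomputable def integralUpTo (F : Type*) [NormedAddCommGroup F] [NormedSpace ℝ F]
    {T t : ℝ} (ht : t ∈ Icc 0 T) : Lp F ∞ (volume.restrict (Icc (0 : ℝ) T)) →L[ℝ] F :=
  LinearMap.mkContinuous
    { toFun := fun g => ∫ s in (0 : ℝ)..t, g s
      map_add' := fun g₁ g₂ => by
        have h0 : (0 : ℝ) ∈ Icc 0 T := left_mem_Icc.2 (ht.1.trans ht.2)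
        rw [← intervalIntegral.integral_add (intervalIntegrable_of_mem_Lp_top g₁ h0 ht)
          (intervalIntegrable_of_mem_Lp_top g₂ h0 ht)]
        refine intervalIntegral.integral_congr_ae ?_
        filter_upwards [(ae_restrict_iff' measurableSet_Icc).1 (Lp.coeFn_add g₁ g₂)] with s hs hs'
        exact hs (uIcc_subset_Icc h0 ht (uIoc_subset_uIcc hs'))
      map_smul' := fun c g => by
        have h0 : (0 : ℝ) ∈ Icc 0 T := left_mem_Icc.2 (ht.1.trans ht.2)
        rw [RingHom.id_apply, ← intervalIntegral.integral_smul]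
        refine intervalIntegral.integral_congr_ae ?_
        filter_upwards [(ae_restrict_iff' measurableSet_Icc).1 (Lp.coeFn_smul c g)] with s hs hs'
        exact hs (uIcc_subset_Icc h0 ht (uIoc_subset_uIcc hs')) }
    |t - 0| fun g => by
      rw [mul_comm]
      exact norm_intervalIntegral_le_of_mem_Lp_top g (left_mem_Icc.2 (ht.1.trans ht.2)) ht

/-- The Volterra operator `g ↦ ∫_0^· g` on `L^∞([0,T])`. -/
noncomputable def volterra (F : Type*) [NormedAddCommGroup F] [NormedSpace ℝ F] (T : ℝ) :
    Lp F ∞ (volume.restrict (Icc (0 : ℝ) T)) →L[ℝ] Lp F ∞ (volume.restrict (Icc (0 : ℝ) T)) :=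
  LinearMap.mkContinuous
    { toFun := fun g => (memLp_top_intervalIntegral g).toLp _
      map_add' := fun g₁ g₂ => by
        rw [← MemLp.toLp_add]
        refine MemLp.toLp_congr _ _ ?_
        filter_upwards [ae_restrict_mem measurableSet_Icc] with t ht
        exact map_add (integralUpTo F ht) g₁ g₂
      map_smul' := fun c g => by
        rw [RingHom.id_apply, ← MemLp.toLp_const_smul]
        refine MemLp.toLp_congr _ _ ?_
        filter_upwards [ae_restrict_mem measurableSet_Icc] with t ht
        exact map_smul (integralUpTo F ht) c g }
    |T| fun g => by
      refine Lp.norm_top_le_of_ae_bound (by positivity) ?_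
      filter_upwards [ae_restrict_mem measurableSet_Icc, (memLp_top_intervalIntegral g).coeFn_toLp]
        with t ht h
      simp only [LinearMap.coe_mk, AddHom.coe_mk, h]
      refine (norm_intervalIntegral_le_of_mem_Lp_top g
        (left_mem_Icc.2 (ht.1.trans ht.2)) ht).trans ?_
      rw [sub_zero, abs_of_nonneg ht.1, mul_comm]
      exact mul_le_mul_of_nonneg_right (ht.2.trans (le_abs_self T)) (norm_nonneg _)

theorem coeFn_volterra (g : Lp F ∞ (volume.restrict (Icc (0 : ℝ) T))) :
    volterra F T g =ᵐ[volume.restrict (Icc (0 : ℝ) T)] fun t => ∫ s in (0 : ℝ)..t, g s :=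
  (memLp_top_intervalIntegral g).coeFn_toLp

theorem intervalIntegral_pow_div_factorial (C t : ℝ) (k : ℕ) :
    ∫ s in (0 : ℝ)..t, C * ((C * s) ^ k / k.factorial) = (C * t) ^ (k + 1) / (k + 1).factorial := by
  simp only [mul_pow, intervalIntegral.integral_const_mul, intervalIntegral.integral_div,
    integral_pow]
  rw [Nat.factorial_succ]
  push_cast
  have : (k.factorial : ℝ) ≠ 0 := by positivity
  field_simp
  ring

/-- The iterates of a Volterra operator with bounded kernel decay factorially. -/
theorem ae_norm_volterra_comp_pow_le
    {M : Lp F ∞ (volume.restrict (Icc (0 : ℝ) T)) →L[ℝ] Lp F ∞ (volume.restrict (Icc (0 : ℝ) T))}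
    {C : ℝ} (hC : 0 ≤ C)
    (hM : ∀ y, ∀ᵐ t ∂(volume.restrict (Icc (0 : ℝ) T)), ‖M y t‖ ≤ C * ‖y t‖) (k : ℕ)
    (y : Lp F ∞ (volume.restrict (Icc (0 : ℝ) T))) :
    ∀ᵐ t ∂(volume.restrict (Icc (0 : ℝ) T)),
      ‖((volterra F T ∘L M) ^ k) y t‖ ≤ ‖y‖ * ((C * t) ^ k / k.factorial) := by
  induction k with
  | zero => simpa using Lp.ae_norm_le_norm y
  | succ k ih =>
    rw [pow_succ']
    filter_upwards [ae_restrict_mem measurableSet_Icc,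
      coeFn_volterra (M (((volterra F T ∘L M) ^ k) y))] with t ht hJ
    simp only [mul_apply_eq_comp, ContinuousLinearMap.comp_apply] at hJ ⊢
    -- The target bound is written as the integral of `C` times the previous one, leaving a
    -- comparison of integrands.
    rw [hJ, ← intervalIntegral_pow_div_factorial, ← intervalIntegral.integral_const_mul]
    refine intervalIntegral.norm_integral_le_of_norm_le ht.1 ?_
      (Continuous.intervalIntegrable (by fun_prop) _ _)
    filter_upwards [(ae_restrict_iff' measurableSet_Icc).1 ih,
      (ae_restrict_iff' measurableSet_Icc).1 (hM (((volterra F T ∘L M) ^ k) y))] with s h1 h2 hs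
    have hs' : s ∈ Icc 0 T := ⟨hs.1.le, hs.2.trans ht.2⟩
    refine (h2 hs').trans ((mul_le_mul_of_nonneg_left (h1 hs') hC).trans_eq (by ring))

/-- Factorial decay makes some power `K ^ k` a strict contraction, without smallness of `C` or `T`.
Then `1 - K ^ k` is a unit, and so is its commuting factor `1 - K`. -/
theorem isUnit_one_sub_volterra_comp
    {M : Lp F ∞ (volume.restrict (Icc (0 : ℝ) T)) →L[ℝ] Lp F ∞ (volume.restrict (Icc (0 : ℝ) T))}
    [CompleteSpace F] {C : ℝ} (hC : 0 ≤ C)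
    (hM : ∀ y, ∀ᵐ t ∂(volume.restrict (Icc (0 : ℝ) T)), ‖M y t‖ ≤ C * ‖y t‖) :
    IsUnit (1 - volterra F T ∘L M) := by
  set K := volterra F T ∘L M with hK
  have hlim := FloorSemiring.tendsto_pow_div_factorial_atTop (C * |T|)
  obtain ⟨k, hk⟩ := (hlim.eventually_lt_const zero_lt_one).exists
  have hKk : ‖K ^ k‖ < 1 := by
    refine (ContinuousLinearMap.opNorm_le_bound _ (by positivity) fun y => ?_).trans_lt hk
    refine Lp.norm_top_le_of_ae_bound (by positivity) ?_
    filter_upwards [ae_norm_volterra_comp_pow_le hC hM k y,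
      ae_restrict_mem measurableSet_Icc] with t ht htT
    refine ht.trans ?_
    rw [mul_comm]
    have h0 := htT.1
    have := htT.2.trans (le_abs_self T)
    gcongr
  have h1 : IsUnit ((1 - K) * ∑ i ∈ Finset.range k, K ^ i) := by
    rw [mul_neg_geom_sum]
    exact isUnit_one_sub_of_norm_lt_one hKk
  have hcomm : Commute (1 - K) (∑ i ∈ Finset.range k, K ^ i) := by
    rw [Commute, SemiconjBy, mul_neg_geom_sum, geom_sum_mul_neg]
  exact (hcomm.isUnit_mul_iff.1 h1).1

end Volterra

/-! ### Gronwall, Lipschitz bounds on balls, and pairing of `L^∞` functions. -/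

section Auxiliary

/-- The homogeneous Gronwall inequality in integral form. -/
theorem nonpos_of_le_mul_intervalIntegral {T C : ℝ} {d : ℝ → ℝ} (hd : ContinuousOn d (Icc 0 T))
    (hd0 : ∀ t ∈ Icc 0 T, 0 ≤ d t) (h : ∀ t ∈ Icc 0 T, d t ≤ C * ∫ s in (0 : ℝ)..t, d s) :
    ∀ t ∈ Icc 0 T, d t ≤ 0 := by
  intro t ht
  have hT : 0 ≤ T := ht.1.trans ht.2
  -- Extending `d` by constants outside `[0,T]` makes its primitive differentiable everywhere;
  -- Gronwall is applied to that primitive.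
  let e : ℝ → ℝ := fun t => d (projIcc 0 T hT t)
  have he : Continuous e := hd.comp_continuous (by fun_prop) fun t => (projIcc 0 T hT t).2
  have hed : ∀ t ∈ Icc 0 T, e t = d t := fun t ht => by simp only [e, projIcc_of_mem hT ht]
  have hint : ∀ t ∈ Icc 0 T, ∫ s in (0 : ℝ)..t, e s = ∫ s in (0 : ℝ)..t, d s := fun t ht =>
    intervalIntegral.integral_congr fun s hs =>
      hed s (uIcc_subset_Icc (left_mem_Icc.2 hT) ht hs)
  have hI : ∀ t, HasDerivAt (fun t => ∫ s in (0 : ℝ)..t, e s) (e t) t := fun t =>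
    (he.integral_hasStrictDerivAt 0 t).hasDerivAt
  have hpos : ∀ t ∈ Icc 0 T, 0 ≤ ∫ s in (0 : ℝ)..t, e s := fun t ht =>
    intervalIntegral.integral_nonneg ht.1 fun s hs => by
      rw [hed s ⟨hs.1, hs.2.trans ht.2⟩]; exact hd0 s ⟨hs.1, hs.2.trans ht.2⟩
  have := norm_le_gronwallBound_of_norm_deriv_right_le (f := fun t => ∫ s in (0 : ℝ)..t, e s)
    (f' := e) (δ := 0) (K := C) (ε := 0) (a := 0) (b := T)
    (fun t _ => (hI t).continuousAt.continuousWithinAt) (fun t _ => (hI t).hasDerivWithinAt)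
    (by simp) (fun t ht => by
      have ht' := Ico_subset_Icc_self ht
      rw [add_zero, Real.norm_of_nonneg (hpos t ht'), hed t ht', hint t ht',
        Real.norm_of_nonneg (hd0 t ht')]
      exact h t ht') t ht
  rw [gronwallBound_ε0_δ0, norm_le_zero_iff] at this
  have h1 := h t ht
  rwa [← hint t ht, this, mul_zero] at h1

theorem exists_lipschitz_closedBall {K E F : Type*} [TopologicalSpace K] [CompactSpace K]
    [NormedAddCommGroup E] [ProperSpace E] [NormedAddCommGroup F] [NormedSpace ℝ E]
    [NormedSpace ℝ F] {h : E → K → F} {h' : E → K → E →L[ℝ] F}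
    (hh' : Continuous (Function.uncurry h'))
    (hd : ∀ k x, HasFDerivAt (fun y => h y k) (h' x k) x) (R : ℝ) :
    ∃ L : ℝ, ∀ k, ∀ x ∈ Metric.closedBall (0 : E) R, ∀ y ∈ Metric.closedBall (0 : E) R,
      ‖h x k - h y k‖ ≤ L * ‖x - y‖ := by
  obtain ⟨L, hL⟩ := ((isCompact_closedBall (0 : E) R).prod
    (isCompact_univ (X := K))).exists_bound_of_continuousOn hh'.continuousOn
  exact ⟨L, fun k x hx y hy => (convex_closedBall
    (0 : E) R).norm_image_sub_le_of_norm_hasFDerivWithin_le (f := fun y => h y k)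
    (fun z _ => (hd k z).hasFDerivWithinAt)
    (fun z hz => hL (z, k) ⟨hz, mem_univ _⟩) hy hx⟩

/-- The identification of pairs of elements of `L^p` with elements of `L^p` of the product. -/
noncomputable def lpPair {α E F : Type*} [MeasurableSpace α] (μ : Measure α)
    [NormedAddCommGroup E] [NormedAddCommGroup F] [NormedSpace ℝ E] [NormedSpace ℝ F] :
    Lp F ∞ μ × Lp E ∞ μ →L[ℝ] Lp (E × F) ∞ μ :=
  ((ContinuousLinearMap.inr ℝ E F).compLpL ∞ μ).comp (ContinuousLinearMap.fst ℝ _ _) +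
    ((ContinuousLinearMap.inl ℝ E F).compLpL ∞ μ).comp (ContinuousLinearMap.snd ℝ _ _)

theorem coeFn_lpPair {α E F : Type*} [MeasurableSpace α] {μ : Measure α}
    [NormedAddCommGroup E] [NormedAddCommGroup F] [NormedSpace ℝ E] [NormedSpace ℝ F]
    (q : Lp F ∞ μ × Lp E ∞ μ) : lpPair μ q =ᵐ[μ] fun t => (q.2 t, q.1 t) := by
  filter_upwards [Lp.coeFn_add ((ContinuousLinearMap.inr ℝ E F).compLpL ∞ μ q.1)
      ((ContinuousLinearMap.inl ℝ E F).compLpL ∞ μ q.2),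
    (ContinuousLinearMap.inr ℝ E F).coeFn_compLpL q.1,
    (ContinuousLinearMap.inl ℝ E F).coeFn_compLpL q.2] with t h1 h2 h3
  refine h1.trans ?_
  rw [Pi.add_apply, h2, h3]
  simp

end Auxiliary

/-! ### The dynamics as an operator on `L^∞`. -/

namespace ControlSampling

variable {n m : ℕ} {T : ℝ}
  {f : EuclideanSpace ℝ (Fin n) → EuclideanSpace ℝ (Fin m) → ℝ → EuclideanSpace ℝ (Fin n)}
  {x₀ : EuclideanSpace ℝ (Fin n)}

theorem IsC1Dynamics.continuous (hf : IsC1Dynamics T f) :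
    Continuous (Function.uncurry fun
      (p : EuclideanSpace ℝ (Fin n) × EuclideanSpace ℝ (Fin m)) (k : Icc 0 T) =>
      f p.1 p.2 k) :=
  hf.continuousOn.comp_continuous
    (f := fun q : (EuclideanSpace ℝ (Fin n) × EuclideanSpace ℝ (Fin m)) × Icc 0 T =>
      (q.1, (q.2 : ℝ))) (by fun_prop) fun q => ⟨mem_univ _, q.2.2⟩

theorem IsC1Dynamics.continuous_fderiv (hf : IsC1Dynamics T f) :
    Continuous (Function.uncurry fun
      (p : EuclideanSpace ℝ (Fin n) × EuclideanSpace ℝ (Fin m)) (k : Icc 0 T) =>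
      fderiv ℝ (fun p : EuclideanSpace ℝ (Fin n) × EuclideanSpace ℝ (Fin m) => f p.1 p.2 k) p) :=
  hf.continuousOn_fderiv.comp_continuous
    (f := fun q : (EuclideanSpace ℝ (Fin n) × EuclideanSpace ℝ (Fin m)) × Icc 0 T =>
      (q.1, (q.2 : ℝ))) (by fun_prop) fun q => ⟨mem_univ _, q.2.2⟩

theorem IsC1Dynamics.hasFDerivAt (hf : IsC1Dynamics T f) (k : Icc 0 T)
    (p : EuclideanSpace ℝ (Fin n) × EuclideanSpace ℝ (Fin m)) :
    HasFDerivAt (fun p : EuclideanSpace ℝ (Fin n) × EuclideanSpace ℝ (Fin m) => f p.1 p.2 k)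
      (fderiv ℝ (fun p : EuclideanSpace ℝ (Fin n) × EuclideanSpace ℝ (Fin m) => f p.1 p.2 k) p)
      p :=
  (hf.differentiable k k.2 p).hasFDerivAt

/-- Time enters through its clamping to `[0,T]`, which provides the compact parameter space required
by `nemytskii` and changes nothing on `[0,T]`. -/
theorem aestronglyMeasurable_projIcc (hT : 0 ≤ T) (μ : Measure ℝ) :
    AEStronglyMeasurable (projIcc 0 T hT) μ :=
  continuous_projIcc.aestronglyMeasurable

/-- The velocity `t ↦ f(x(t),u(t),t)` as an element of `L^∞`, for `(u, x)` in `L^∞`. -/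
noncomputable def velocity (hT : 0 ≤ T) (hf : IsC1Dynamics T f)
    (q : Control m T × Control n T) : Control n T :=
  nemytskii hf.continuous (aestronglyMeasurable_projIcc hT _) (lpPair _ q)

theorem coeFn_velocity (hT : 0 ≤ T) (hf : IsC1Dynamics T f) (q : Control m T × Control n T) :
    velocity hT hf q =ᵐ[volume.restrict (Icc (0 : ℝ) T)] fun t => f (q.2 t) (q.1 t) t := by
  filter_upwards [coeFn_nemytskii hf.continuous (aestronglyMeasurable_projIcc hT _) (lpPair _ q),
    coeFn_lpPair q, ae_restrict_mem measurableSet_Icc] with t h1 h2 ht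
  refine h1.trans ?_
  rw [h2, projIcc_of_mem hT ht]

/-- A strict derivative of the velocity operator whose partial derivative in the state is a
multiplication operator. -/
theorem exists_hasStrictFDerivAt_velocity (hT : 0 ≤ T) (hf : IsC1Dynamics T f)
    (q : Control m T × Control n T) :
    ∃ N : Control m T × Control n T →L[ℝ] Control n T,
      HasStrictFDerivAt (velocity hT hf) N q ∧ ∃ C : ℝ, 0 ≤ C ∧ ∀ y : Control n T,
        ∀ᵐ t ∂(volume.restrict (Icc (0 : ℝ) T)), ‖N (0, y) t‖ ≤ C * ‖y t‖ := by
  have h := (hasStrictFDerivAt_nemytskii hf.continuous hf.continuous_fderiv hf.hasFDerivAt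
    (aestronglyMeasurable_projIcc hT (volume.restrict (Icc (0 : ℝ) T))) (lpPair _ q)).comp q
    (lpPair _).hasStrictFDerivAt
  refine ⟨_, h, ?_⟩
  set A := nemytskii hf.continuous_fderiv
    (aestronglyMeasurable_projIcc hT (volume.restrict (Icc (0 : ℝ) T))) (lpPair _ q)
  refine ⟨‖A‖, norm_nonneg _, fun y => ?_⟩
  filter_upwards [ContinuousLinearMap.coeFn_holder (r := ∞) (ContinuousLinearMap.id ℝ
      (EuclideanSpace ℝ (Fin n) × EuclideanSpace ℝ (Fin m) →L[ℝ] EuclideanSpace ℝ (Fin n))) A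
      (lpPair _ ((0 : Control m T), y)),
    coeFn_lpPair ((0 : Control m T), y), Lp.ae_norm_le_norm A,
    Lp.coeFn_zero (EuclideanSpace ℝ (Fin m)) ∞ (volume.restrict (Icc (0 : ℝ) T))]
    with t h1 h2 h3 h4
  simp only [ContinuousLinearMap.comp_apply, ContinuousLinearMap.holderL_apply_apply]
  rw [h1, h2]
  simp only [h4, ContinuousLinearMap.id_apply, Pi.zero_apply]
  refine (ContinuousLinearMap.le_opNorm _ _).trans (mul_le_mul h3 ?_ (norm_nonneg _)
    (norm_nonneg _))
  simp

/-! ### Trajectories and the integral equation. -/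

theorem IsSolution.memLp {x : ℝ → EuclideanSpace ℝ (Fin n)} {v : Control m T} (hT : 0 ≤ T)
    (hx : IsSolution T f x v) : MemLp x ∞ (volume.restrict (Icc (0 : ℝ) T)) := by
  have hc : ContinuousOn x (Icc 0 T) := by simpa [uIcc_of_le hT] using hx.1.continuousOn
  obtain ⟨C, hC⟩ := isCompact_Icc.exists_bound_of_continuousOn hc
  refine memLp_top_of_bound (hc.aestronglyMeasurable measurableSet_Icc) C ?_
  filter_upwards [ae_restrict_mem measurableSet_Icc] with t ht using hC t ht

theorem absolutelyContinuousOnInterval_intervalIntegral (hT : 0 ≤ T) (g : Control n T) :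
    AbsolutelyContinuousOnInterval (fun t => ∫ s in (0 : ℝ)..t, g s) 0 T :=
  LipschitzOnWith.absolutelyContinuousOnInterval (K := ‖g‖₊) (by
    rw [uIcc_of_le hT]; exact lipschitzOnWith_intervalIntegral_of_mem_Lp_top g)

theorem ae_hasDerivAt_intervalIntegral (hT : 0 ≤ T) (g : Control n T) :
    ∀ᵐ t ∂(volume.restrict (Icc (0 : ℝ) T)),
      HasDerivAt (fun t => ∫ s in (0 : ℝ)..t, g s) (g t) t := by
  have h0 : (0 : ℝ) ∈ Icc 0 T := left_mem_Icc.2 hT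
  have := (intervalIntegrable_of_mem_Lp_top g h0 (right_mem_Icc.2 hT)).ae_hasDerivAt_integral
  rw [ae_restrict_iff' measurableSet_Icc]
  rw [uIcc_of_le hT] at this
  filter_upwards [this] with t ht htT using ht htT 0 h0

/-- Solutions satisfy the integral equation. -/
theorem IsSolution.eq_add_intervalIntegral {x : ℝ → EuclideanSpace ℝ (Fin n)} {v : Control m T}
    (hT : 0 ≤ T) (hf : IsC1Dynamics T f) (hx : IsSolution T f x v) {t : ℝ} (ht : t ∈ Icc 0 T) :
    x t = x 0 + ∫ s in (0 : ℝ)..t, velocity hT hf (v, (hx.memLp hT).toLp x) s := by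
  set g := velocity hT hf (v, (hx.memLp hT).toLp x) with hg
  -- The difference of `x` and the primitive of its velocity is absolutely continuous with zero
  -- derivative a.e., hence constant.
  obtain ⟨c, hc⟩ := (hx.1.sub
    (absolutelyContinuousOnInterval_intervalIntegral hT g)).const_of_ae_hasDerivAt_zero (by
      rw [uIcc_of_le hT, ← ae_restrict_iff' measurableSet_Icc]
      filter_upwards [hx.2, ae_hasDerivAt_intervalIntegral hT g, coeFn_velocity hT hf
        (v, (hx.memLp hT).toLp x), (hx.memLp hT).coeFn_toLp] with t h1 h2 h3 h4
      have := h1.sub h2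
      rwa [hg, h3, h4, sub_self] at this)
  rw [uIcc_of_le hT] at hc
  have h1 := hc t ht
  have h0 := hc 0 (left_mem_Icc.2 hT)
  simp only [Pi.sub_apply, intervalIntegral.integral_same, sub_zero] at h0 h1
  rw [h0, ← h1, sub_add_cancel]

/-- Solutions of the integral equation in `L^∞` are solutions of the control system. -/
theorem isSolution_of_sub_volterra_eq_const (hT : 0 ≤ T) (hf : IsC1Dynamics T f)
    {q : Control m T × Control n T}
    (hq : q.2 - volterra _ T (velocity hT hf q) = Lp.const ∞ _ x₀) :
    IsSolution T f (fun t => x₀ + ∫ s in (0 : ℝ)..t, velocity hT hf q s) q.1 := by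
  constructor
  · exact (LipschitzWith.const x₀).lipschitzOnWith.absolutelyContinuousOnInterval.add
      (absolutelyContinuousOnInterval_intervalIntegral hT _)
  · rw [sub_eq_iff_eq_add] at hq
    filter_upwards [ae_hasDerivAt_intervalIntegral hT (velocity hT hf q),
      coeFn_velocity hT hf q, coeFn_volterra (velocity hT hf q),
      Lp.coeFn_add (Lp.const ∞ (volume.restrict (Icc (0 : ℝ) T)) x₀)
        (volterra _ T (velocity hT hf q)),
      Lp.coeFn_const ∞ (volume.restrict (Icc (0 : ℝ) T)) x₀] with t h1 h2 h3 h4 h5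
    have : x₀ + ∫ s in (0 : ℝ)..t, velocity hT hf q s = q.2 t := by
      rw [hq, h4, Pi.add_apply, h3, h5]; rfl
    rw [this, ← h2]
    exact h1.const_add x₀

theorem IsSolution.sub_volterra_eq_const {x : ℝ → EuclideanSpace ℝ (Fin n)} {v : Control m T}
    (hT : 0 ≤ T) (hf : IsC1Dynamics T f) (hx : IsSolution T f x v) :
    (hx.memLp hT).toLp x - volterra _ T (velocity hT hf (v, (hx.memLp hT).toLp x)) =
      Lp.const ∞ _ (x 0) := by
  rw [sub_eq_iff_eq_add]
  refine Lp.ext ?_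
  filter_upwards [(hx.memLp hT).coeFn_toLp,
    coeFn_volterra (velocity hT hf (v, (hx.memLp hT).toLp x)),
    Lp.coeFn_add (Lp.const ∞ (volume.restrict (Icc (0 : ℝ) T)) (x 0))
      (volterra _ T (velocity hT hf (v, (hx.memLp hT).toLp x))),
    Lp.coeFn_const ∞ (volume.restrict (Icc (0 : ℝ) T)) (x 0),
    ae_restrict_mem measurableSet_Icc] with t h1 h2 h3 h4 ht
  rw [h1, h3, Pi.add_apply, h2, h4]
  exact hx.eq_add_intervalIntegral hT hf ht

/-- Uniqueness of trajectories. -/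
theorem IsSolution.eqOn {x y : ℝ → EuclideanSpace ℝ (Fin n)} {v : Control m T} (hT : 0 ≤ T)
    (hf : IsC1Dynamics T f) (hx : IsSolution T f x v) (hy : IsSolution T f y v)
    (hxy : x 0 = y 0) : EqOn x y (Icc 0 T) := by
  have hxc : ContinuousOn x (Icc 0 T) := by simpa [uIcc_of_le hT] using hx.1.continuousOn
  have hyc : ContinuousOn y (Icc 0 T) := by simpa [uIcc_of_le hT] using hy.1.continuousOn
  obtain ⟨A, hA⟩ := isCompact_Icc.exists_bound_of_continuousOn hxc
  obtain ⟨B, hB⟩ := isCompact_Icc.exists_bound_of_continuousOn hyc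
  -- This ball contains `(x s, v s)` and `(y s, v s)` for a.e. `s`, so one Lipschitz constant serves
  -- in Gronwall.
  obtain ⟨L, hL⟩ := exists_lipschitz_closedBall hf.continuous_fderiv hf.hasFDerivAt
    (max (max A B) ‖v‖)
  have hd : ContinuousOn (fun t => ‖x t - y t‖) (Icc 0 T) := (hxc.sub hyc).norm
  have key := nonpos_of_le_mul_intervalIntegral (C := L) hd (fun t _ => norm_nonneg _)
    fun t ht => ?_
  · intro t ht
    exact sub_eq_zero.1 (norm_le_zero_iff.1 (key t ht))
  · have h0 : (0 : ℝ) ∈ Icc 0 T := left_mem_Icc.2 hT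
    rw [hx.eq_add_intervalIntegral hT hf ht, hy.eq_add_intervalIntegral hT hf ht, hxy,
      add_sub_add_left_eq_sub, ← intervalIntegral.integral_sub
        (intervalIntegrable_of_mem_Lp_top _ h0 ht) (intervalIntegrable_of_mem_Lp_top _ h0 ht),
      ← intervalIntegral.integral_const_mul]
    have hsub : uIcc 0 t ⊆ Icc 0 T := uIcc_subset_Icc h0 ht
    refine intervalIntegral.norm_integral_le_of_norm_le ht.1 ?_
      ((hd.mono hsub).intervalIntegrable.const_mul L)
    filter_upwards [(ae_restrict_iff' measurableSet_Icc).1 (coeFn_velocity hT hf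
        (v, (hx.memLp hT).toLp x)), (ae_restrict_iff' measurableSet_Icc).1
        (coeFn_velocity hT hf (v, (hy.memLp hT).toLp y)),
      (ae_restrict_iff' measurableSet_Icc).1 (hx.memLp hT).coeFn_toLp,
      (ae_restrict_iff' measurableSet_Icc).1 (hy.memLp hT).coeFn_toLp,
      (ae_restrict_iff' measurableSet_Icc).1 (Lp.ae_norm_le_norm v)] with s h1 h2 h3 h4 h5 hs
    have hs' : s ∈ Icc 0 T := ⟨hs.1.le, hs.2.trans ht.2⟩
    rw [h1 hs', h2 hs', h3 hs', h4 hs']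
    have := hL ⟨s, hs'⟩ (x s, v s) ?_ (y s, v s) ?_
    · simpa [Prod.norm_def] using this
    · rw [mem_closedBall_zero_iff, Prod.norm_def]
      exact max_le_max ((hA s hs').trans (le_max_left _ _)) (h5 hs')
    · rw [mem_closedBall_zero_iff, Prod.norm_def]
      exact max_le_max ((hB s hs').trans (le_max_right _ _)) (h5 hs')

theorem endpointMap_eq {x : ℝ → EuclideanSpace ℝ (Fin n)} {v : Control m T} (hT : 0 ≤ T)
    (hf : IsC1Dynamics T f) (hx : IsSolution T f x v) (hx0 : x 0 = x₀) :
    endpointMap T f x₀ v = x T := by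
  have hv : v ∈ admissibleControls T f x₀ := ⟨x, hx0, hx⟩
  rw [endpointMap, trajectory, dif_pos hv]
  exact hv.choose_spec.2.eqOn hT hf hx (hv.choose_spec.1.trans hx0.symm) (right_mem_Icc.2 hT)

theorem isReachable_endpointMap {U : Set (EuclideanSpace ℝ (Fin m))} {v : Control m T}
    (hv : v ∈ admissibleControls T f x₀ ∩ controlsIn T U) :
    IsReachable T f x₀ U (endpointMap T f x₀ v) := by
  refine ⟨hv.1.choose, v, hv.1.choose_spec.2, hv.2, hv.1.choose_spec.1, ?_⟩
  rw [endpointMap, trajectory, dif_pos hv.1]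

/-! ### Strict differentiability of the end-point mapping. -/

/-- Controls close to an admissible control are admissible, and the end-point mapping is strictly
differentiable there. -/
theorem exists_hasStrictFDerivAt_endpointMap (hT : 0 ≤ T) (hf : IsC1Dynamics T f)
    {u : Control m T} (hu : u ∈ admissibleControls T f x₀) :
    admissibleControls T f x₀ ∈ 𝓝 u ∧
      ∃ D : Control m T →L[ℝ] EuclideanSpace ℝ (Fin n),
        HasStrictFDerivAt (endpointMap T f x₀) D u := by
  obtain ⟨x, rfl, hx⟩ := hu
  set X := (hx.memLp hT).toLp x
  obtain ⟨N, hN, C, hC, hNC⟩ := exists_hasStrictFDerivAt_velocity hT hf (u, X)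
  -- Trajectories from `x 0` correspond to the level set of `Φ` at the constant `x 0`, which passes
  -- through `(u, X)`.
  let Φ : Control m T × Control n T → Control n T := fun q =>
    q.2 - volterra _ T (velocity hT hf q)
  have hΦ : HasStrictFDerivAt Φ (ContinuousLinearMap.snd ℝ _ _ - volterra _ T ∘L N) (u, X) :=
    hasStrictFDerivAt_snd.sub ((volterra _ T).hasStrictFDerivAt.comp (u, X) hN)
  have hinv : ((ContinuousLinearMap.snd ℝ _ _ - volterra _ T ∘L N) ∘L
      ContinuousLinearMap.inr ℝ (Control m T) (Control n T)).IsInvertible := by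
    obtain ⟨e, he⟩ := isUnit_one_sub_volterra_comp
      (M := N ∘L ContinuousLinearMap.inr ℝ (Control m T) (Control n T)) hC hNC
    refine ⟨ContinuousLinearEquiv.unitsEquiv ℝ _ e, ?_⟩
    ext1 y
    exact DFunLike.congr_fun he y
  let φ := hΦ.implicitFunctionOfProdDomain hinv
  have hφ : HasStrictFDerivAt φ _ u := hΦ.hasStrictFDerivAt_implicitFunctionOfProdDomain hinv
  have hφu : φ u = X :=
    (hΦ.eventually_apply_eq_iff_implicitFunctionOfProdDomain hinv).self_of_nhds.1 rfl
  have hsol : ∀ᶠ v in 𝓝 u, IsSolution T f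
      (fun t => x 0 + ∫ s in (0 : ℝ)..t, velocity hT hf (v, φ v) s) v := by
    filter_upwards [hΦ.eventually_apply_implicitFunctionOfProdDomain hinv] with v hv
    exact isSolution_of_sub_volterra_eq_const hT hf (q := (v, φ v))
      (hv.trans (hx.sub_volterra_eq_const hT hf))
  refine ⟨?_, ?_⟩
  · filter_upwards [hsol] with v hv
    exact ⟨_, by simp, hv⟩
  · have hpair : HasStrictFDerivAt (fun v => (v, φ v)) _ u := (hasStrictFDerivAt_id u).prodMk hφ
    rw [← hφu] at hN
    -- Evaluation at `T` is meaningless on `L^∞` classes; the end point is instead `x 0` plus the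
    -- integral of the velocity, a continuous linear functional of that velocity.
    have hE := ((integralUpTo _ (right_mem_Icc.2 hT)).hasStrictFDerivAt.comp u
      (hN.comp u hpair)).const_add (x 0)
    refine ⟨_, hE.congr_of_eventuallyEq ?_⟩
    filter_upwards [hsol] with v hv
    exact (endpointMap_eq hT hf hv (by simp)).symm

theorem convex_controlsIn {U : Set (EuclideanSpace ℝ (Fin m))} (hU : Convex ℝ U) :
    Convex ℝ (controlsIn T U) := by
  intro v hv w hw a b ha hb hab
  filter_upwards [hv, hw, Lp.coeFn_add (a • v) (b • w), Lp.coeFn_smul a v, Lp.coeFn_smul b w]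
    with t h1 h2 h3 h4 h5
  rw [h3, Pi.add_apply, h4, h5]
  exact hU h1 h2 ha hb hab

end ControlSampling

theorem proposition3 {n m : ℕ} {T : ℝ} (hT : 0 < T)
    (f : EuclideanSpace ℝ (Fin n) → EuclideanSpace ℝ (Fin m) → ℝ → EuclideanSpace ℝ (Fin n))
    (hf : ControlSampling.IsC1Dynamics T f)
    (x₀ : EuclideanSpace ℝ (Fin n))
    (U : Set (EuclideanSpace ℝ (Fin m))) (hU : Convex ℝ U)
    (u : ControlSampling.Control m T)
    (hu : u ∈ ControlSampling.admissibleControls T f x₀ ∩ ControlSampling.controlsIn T U)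
    (hreg : ControlSampling.IsStronglyURegular T f x₀ U u) :
    (∃ (𝒱 : Set (EuclideanSpace ℝ (Fin n)))
        (V : EuclideanSpace ℝ (Fin n) → ControlSampling.Control m T),
      IsOpen 𝒱 ∧ ControlSampling.endpointMap T f x₀ u ∈ 𝒱 ∧
      ContinuousOn V 𝒱 ∧
      (∀ z ∈ 𝒱,
        V z ∈ ControlSampling.admissibleControls T f x₀ ∩ ControlSampling.controlsIn T U) ∧
      V (ControlSampling.endpointMap T f x₀ u) = u ∧
      (∀ z ∈ 𝒱, ControlSampling.endpointMap T f x₀ (V z) = z) ∧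
      (∀ z ∈ 𝒱, ControlSampling.IsReachable T f x₀ U z)) ∧
    ControlSampling.endpointMap T f x₀ u ∈
      interior (ControlSampling.accessibleSet T f x₀ U) := by
  obtain ⟨hopen, D, hD⟩ := ControlSampling.exists_hasStrictFDerivAt_endpointMap hT.le hf hu.1
  -- The strict derivative `D` is the Fréchet derivative, so regularity is a surjectivity statement
  -- about `D`.
  rw [ControlSampling.IsStronglyURegular, hD.hasFDerivAt.fderiv] at hreg
  obtain ⟨𝒱, V, h𝒱, hu𝒱, hVc, hV, hVu, hEV⟩ := hD.exists_continuousOn_rightInverse_of_convex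
    (ControlSampling.convex_controlsIn hU) hu.2 hreg hopen
  refine ⟨⟨𝒱, V, h𝒱, hu𝒱, hVc, hV, hVu, hEV, fun z hz => ?_⟩, ?_⟩
  · have := ControlSampling.isReachable_endpointMap (hV z hz)
    rwa [hEV z hz] at this
  · exact mem_interior.2 ⟨𝒱, fun z hz => ⟨V z, hV z hz, hEV z hz⟩, h𝒱, hu𝒱⟩
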